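/- Conventions. For an infinite cardinal $\kappa$, $H_\kappa$ is the collection of sets whose transitive closure has cardinality less than $\kappa$, regarded as a structure $(H_\kappa,\in)$. A collection $S$ of subsets of a set $X$ is \emph{stationary} if for every $F:[X]^{<\omega}\to X$ there is $M\in S$ closed under $F$. For $M\prec H_{\aleph_\omega}$ with $|M\cap\aleph_\omega|=\aleph_\omega$, let $\chi_M:\omega\to\omega$ be the function such that $\chi_M(n)$ is the unique $m\ge n$ for which the order type of $M\cap\aleph_m$ is $\aleph_n$. For $f:\omega\to\omega$, say that $\aleph_\omega$ is \emph{$f$-Jónsson} if the collection of all $M\prec H_{\aleph_\omega}$ such that $|M|=|M\cap\aleph_\omega|=\aleph_\omega$ and $\chi_M=f$ is stationary. For a sequence $\vec f=\langle f_i:i<\omega\rangle$ of functions $f_i:\omega\to\omega$ and $g:\omega\to\omega$, define $\vec f^{\,g}:\omega\to\omega$ by $$\vec f^{\,g}(n)=(f_0\circ f_1\circ\dots\circ f_{g(n)-1})(n),$$ where the empty composition is the identity, so $\vec f^{\,g}(n)=n$ if $g(n)=0$. Let $s_1:\omega\to\omega$ be given by $s_1(0)=0$ and $s_1(n)=n+1$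 for $n>0$. Theorem. (1) Suppose $\vec f=\langle f_i:i<\omega\rangle$ is a sequence of functions $f_i:\omega\to\omega$ such that $\aleph_\omega$ is $f_i$-Jónsson for each $i$, and $g:\omega\to\omega$ is monotone ($n<m$ implies $g(n)\le g(m)$). Then $\aleph_\omega$ is $\vec f^{\,g}$-Jónsson. (2) If $\aleph_\omega$ is $s_1$-Jónsson, then $\aleph_\omega$ is $f$-Jónsson for every $f:\omega\to\omega$ that is increasing ($n<m$ implies $f(n)<f(m)$) and satisfies $f(0)=0$. -/

import Mathlib

universe u

namespace Jonsson

open scoped Cardinal Ordinal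

/-- The signature of set theory has a single binary relation symbol. -/
inductive MemRel : ℕ → Type
  | mem : MemRel 2

/-- The first-order language `{∈}` of set theory. -/
def LSet : FirstOrder.Language.{0, 0} := ⟨fun _ => Empty, MemRel⟩

/-- `H_κ`, the collection of sets hereditarily of cardinality less than `κ`: the transitive closure
of `x` (the least transitive set including `x`) has cardinality less than `κ`; equivalently, `x` is
included in some transitive set of cardinality less than `κ`. -/
def H (κ : Cardinal.{u}) : Set ZFSet.{u} :=
  {x | ∃ t : ZFSet.{u}, t.IsTransitive ∧ x ⊆ t ∧ t.card < κ}

/-- `H_κ` as a structure `(H_κ, ∈)`. -/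
instance structureH (κ : Cardinal.{u}) : LSet.Structure (H κ) where
  funMap := fun f => Empty.elim f
  RelMap := fun r => match r with
    | MemRel.mem => fun x => (x 0 : ZFSet.{u}) ∈ (x 1 : ZFSet.{u})

/-- `M ≺ H_κ`: the set `M` is the universe of an elementary substructure of `(H_κ, ∈)`. -/
def IsElementary {κ : Cardinal.{u}} (M : Set (H κ)) : Prop :=
  ∃ N : LSet.ElementarySubstructure (H κ), (N : Set (H κ)) = M

/-- A collection `S` of subsets of `X` is stationary if for every `F : [X]^{<ω} → X`, some member
of `S` is closed under `F`. -/
def Stationary {X : Type*} (S : Set (Set X)) : Prop :=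
  ∀ F : Finset X → X, ∃ M ∈ S, ∀ s : Finset X, (s : Set X) ⊆ M → F s ∈ M

/-- `M ∩ α`, as a set of ordinals (an ordinal is identified with its von Neumann ordinal). -/
def ordPart {κ : Cardinal.{u}} (M : Set (H κ)) (α : Ordinal.{u}) : Set Ordinal.{u} :=
  {β | β < α ∧ ∃ x ∈ M, (x : ZFSet.{u}) = β.toZFSet}

/-- The order type of a set of ordinals. -/
noncomputable def ot (A : Set Ordinal.{u}) : Ordinal.{u + 1} :=
  Ordinal.type (fun a b : A => a < b)

/-- `χ_M = f`: for every `n`, `f n` is the `m ≥ n` such that `ot(M ∩ ℵ_m) = ℵ_n`.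
If `M ≺ H_{ℵ_ω}` there is at most one such `m` for each `n`, because every `ℵ_m` belongs to `M`, so
that `ot(M ∩ ℵ_m)` strictly increases with `m`. The condition forces `|M ∩ ℵ_ω| = ℵ_ω`. -/
def ChiEq {κ : Cardinal.{u}} (M : Set (H κ)) (f : ℕ → ℕ) : Prop :=
  ∀ n : ℕ, n ≤ f n ∧ ot (ordPart M (ω_ (f n : Ordinal.{u}))) = ω_ (n : Ordinal.{u + 1})

/-- `ℵ_ω` is `f`-Jónsson: the collection of all `M ≺ H_{ℵ_ω}` with `|M| = ℵ_ω` and `χ_M = f` is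
stationary. -/
def FJonsson (f : ℕ → ℕ) : Prop :=
  Stationary {M : Set (H.{u} (ℵ_ Ordinal.omega0.{u})) |
    IsElementary M ∧ Cardinal.mk M = ℵ_ Ordinal.omega0.{u + 1} ∧ ChiEq M f}

/-- `compFirst f k = f 0 ∘ f 1 ∘ ⋯ ∘ f (k - 1)`, the identity for `k = 0`. -/
def compFirst (f : ℕ → ℕ → ℕ) : ℕ → ℕ → ℕ
  | 0 => id
  | k + 1 => compFirst f k ∘ f k

/-- The exponentiation `f^g` of a sequence `f` of functions by a function `g`:
`n ↦ (f 0 ∘ f 1 ∘ ⋯ ∘ f (g n - 1)) n`. -/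
def seqPow (f : ℕ → ℕ → ℕ) (g : ℕ → ℕ) : ℕ → ℕ :=
  fun n => compFirst f (g n) n

/-- The function `0 ↦ 0` and `n ↦ n + 1` for `n > 0`. -/
def s₁ : ℕ → ℕ := fun n => if n = 0 then 0 else n + 1

end Jonsson

/-!
The proof replaces models by algebras on the ordinal `ℵ_ω`. Taking Skolem hulls, `ℵ_ω` is
`f`-Jónsson if and only if every algebra on `ℵ_ω` with countably many finitary operations has a
subalgebra `A` such that `A ∩ ℵ_{f n}` has order type `ℵ_n` for all `n` (`algJonsson_of_fJonsson`,
`fJonsson_of_algJonsson`). In terms of the increasing enumeration `e : ℵ_ω → A` this says that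
`e x < ℵ_{f n} ↔ x < ℵ_n`. Along `e` the operations of the algebra can be pulled back to `ℵ_ω`, so
subalgebras can be taken repeatedly; composing enumerations composes the functions `f`.

For the power `f^g`, the `k`-th step should act only at those `n` with `k < g n`, which by
monotonicity of `g` form a final segment of `ℕ`. This is possible by `AlgJonsson.exists_fix`: if a
subalgebra `A` is closed under enough operations, then adding all ordinals below `ℵ_n` to it does
not change the order type of `A ∩ ℵ_{f j}` for `j > n`, because `A` remains cofinal in the larger
algebra below each `ℵ_m` with `m > n`. The `k`-th enumeration is then the identity on `ℵ_n` whenever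
`g n ≤ k`, so that the infinite composition of the enumerations stabilizes at every ordinal, and
its range is a subalgebra of type `f^g` (`algJonsson_seqPow`).

For an increasing `f` with `f 0 = 0`, the function `g n = f n - n` is monotone, and `f` is the
power by `g` of the constant sequence `s₁`.
-/

namespace Jonsson

open scoped Cardinal Ordinal
open FirstOrder FirstOrder.Language

/-! ### Algebras on a set -/

/-- `A` is closed under every function of the family `F` of functions `[X]^{<ω} → X`. -/
def ClosedFam {ι X : Type*} (F : ι → Finset X → X) (A : Set X) : Prop :=
  ∀ i (s : Finset X), (s : Set X) ⊆ A → F i s ∈ A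

/-- A countable family of functions `[X]^{<ω} → X` on an infinite set can be coded by a single one.
A copy of `ℕ` inside `X` is generated by singling out the finite sets which contain no natural
number, only `0`, or at least two natural numbers; a finite set whose only natural number is
`k + 1` is then free to be read as a pair of an index and an argument, both decoded from `k`. -/
theorem exists_single_of_closedFam {X : Type*} [Infinite X] (F : ℕ → Finset X → X) :
    ∃ G : Finset X → X, ∀ A : Set X, (∀ s : Finset X, (s : Set X) ⊆ A → G s ∈ A) →
      ClosedFam F A := by
  classical
  let ν : ℕ ↪ X := Infinite.natEmbedding X
  let nat : Finset X → Finset ℕ := fun s => s.preimage ν ν.injective.injOn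
  let rest : Finset X → Finset X := fun s => s.filter (· ∉ Set.range ν)
  let G : Finset X → X := fun s =>
    if nat s = ∅ then ν 0
    else if nat s = {0} then ν 1
    else if 2 ≤ (nat s).card then ν ((nat s).sup id + 1)
    else
      let p := (Encodable.decode (α := ℕ × Finset ℕ) ((nat s).sup id - 1)).getD (0, ∅)
      F p.1 (p.2.map ν ∪ rest s)
  refine ⟨G, fun A hA => ?_⟩
  have nat_map : ∀ t : Finset ℕ, nat (t.map ν) = t := by
    intro t; ext k; simp [nat]
  have h0 : ν 0 ∈ A := by
    have := hA ∅ (by simp)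
    have h : nat ∅ = ∅ := by simp [nat]
    simpa [G, h] using this
  have h1 : ν 1 ∈ A := by
    have := hA (({0} : Finset ℕ).map ν) (by simpa using h0)
    simpa only [G, nat_map, if_true, Finset.singleton_ne_empty, if_false] using this
  have hstep : ∀ k, ν k ∈ A ∧ ν (k + 1) ∈ A := by
    intro k
    induction k with
    | zero => exact ⟨h0, h1⟩
    | succ k ih =>
      refine ⟨ih.2, ?_⟩
      have := hA (({k, k + 1} : Finset ℕ).map ν) (by
        intro x hx
        simp only [Finset.coe_map, Finset.coe_insert, Finset.coe_singleton, Set.mem_image,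
          Set.mem_insert_iff, Set.mem_singleton_iff] at hx
        obtain ⟨j, rfl | rfl, rfl⟩ := hx
        · exact ih.1
        · exact ih.2)
      have hc : ({k, k + 1} : Finset ℕ).card = 2 := by simp
      have hne : ({k, k + 1} : Finset ℕ) ≠ {0} := fun h => by simp [h] at hc
      have hs : ({k, k + 1} : Finset ℕ).sup id = k + 1 := by simp
      simpa only [G, nat_map, hc, hs, hne, if_false, le_refl, if_true,
        Finset.insert_ne_empty] using this
  intro i s hs
  set N := Encodable.encode (i, nat s) with hN
  have hsub : ((({N + 1} : Finset ℕ).map ν ∪ rest s : Finset X) : Set X) ⊆ A := by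
    intro x hx
    simp only [Finset.map_singleton, Finset.coe_union, Finset.coe_singleton, Set.mem_union,
      Set.mem_singleton_iff, Finset.mem_coe, rest, Finset.mem_filter] at hx
    rcases hx with rfl | hx
    · exact (hstep N).2
    · exact hs hx.1
  have key := hA _ hsub
  have hnat : nat (({N + 1} : Finset ℕ).map ν ∪ rest s) = {N + 1} := by
    ext k; simp [nat, rest]
  have hrest : rest (({N + 1} : Finset ℕ).map ν ∪ rest s) = rest s := by
    ext x
    simp only [rest, Finset.map_singleton, Finset.mem_filter, Finset.mem_union,
      Finset.mem_singleton]
    constructor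
    · rintro ⟨rfl | h, h2⟩
      · exact absurd ⟨_, rfl⟩ h2
      · exact h
    · exact fun h => ⟨Or.inr h, h.2⟩
  have hfull : (nat s).map ν ∪ rest s = s := by
    ext x
    simp only [nat, rest, Finset.mem_union, Finset.mem_map, Finset.mem_preimage, Finset.mem_filter,
      Set.mem_range]
    constructor
    · rintro (⟨k, hk, rfl⟩ | h)
      · exact hk
      · exact h.1
    · intro h
      by_cases hx : ∃ y, ν y = x
      · obtain ⟨y, rfl⟩ := hx; exact Or.inl ⟨y, h, rfl⟩
      · exact Or.inr ⟨h, hx⟩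
  simp only [G, hnat, hrest] at key
  simpa [-Encodable.decode_prod_val, -Encodable.encode_prod_val, hN, Encodable.encodek, hfull]
    using key

/-- The language with countably many function symbols of each arity. -/
def funLang : FirstOrder.Language.{0, 0} := ⟨fun _ => ℕ, fun _ => Empty⟩

/-- The structure for `funLang` given by a countable family `F` of functions `[X]^{<ω} → X`: the
`i`-th symbol of any arity applies `F i` to the set of its arguments. -/
@[reducible] noncomputable def funStructure {X : Type*} (F : ℕ → Finset X → X) :
    funLang.Structure X where
  funMap := fun i x => by classical exact F i (Finset.univ.image x)
  RelMap := fun r => Empty.elim r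

theorem closedFam_of_fun_mem {X : Type*} (F : ℕ → Finset X → X) (A : Set X)
    (h : letI := funStructure F
      ∀ (n : ℕ) (i : funLang.Functions n) (x : Fin n → X), (∀ k, x k ∈ A) →
        Structure.funMap i x ∈ A) : ClosedFam F A := by
  classical
  intro i s hs
  have := h s.card i (fun k => (s.equivFin.symm k : X)) (fun k => hs (s.equivFin.symm k).2)
  have h2 : Finset.univ.image (fun k => (s.equivFin.symm k : X)) = s := by
    ext x
    simp only [Finset.mem_image, Finset.mem_univ, true_and]
    constructor
    · rintro ⟨k, rfl⟩; exact (s.equivFin.symm k).2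
    · intro hx; exact ⟨s.equivFin ⟨x, hx⟩, by simp⟩
  change F i (Finset.univ.image _) ∈ A at this
  rwa [h2] at this

/-- An element of the substructure generated by `A` is generated by a finite part of `A`. -/
theorem mem_closure_finset {L : FirstOrder.Language.{0, 0}} {X : Type*} [L.Structure X]
    {A : Set X} {x : X} (hx : x ∈ Substructure.closure L A) :
    ∃ s : Finset X, (s : Set X) ⊆ A ∧ x ∈ Substructure.closure L (s : Set X) := by
  classical
  refine Substructure.closure_induction (p := fun x => ∃ s : Finset X, (s : Set X) ⊆ A ∧
    x ∈ Substructure.closure L (s : Set X)) hx (fun x hx => ?_) ?_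
  · exact ⟨{x}, by simpa using hx, Substructure.subset_closure (by simp)⟩
  · intro n f x h
    choose s hs hs' using h
    refine ⟨Finset.univ.biUnion s, ?_, ?_⟩
    · simpa using hs
    · refine (Substructure.closure L _).fun_mem f x fun k => ?_
      refine Substructure.closure_mono ?_ (hs' k)
      exact_mod_cast Finset.subset_biUnion_of_mem s (Finset.mem_univ k)

theorem mk_closure_le {L : FirstOrder.Language.{0, 0}} [Countable (Σ n, L.Functions n)] {X : Type*}
    [L.Structure X] (A : Set X) : #(Substructure.closure L A) ≤ max ℵ₀ #A := by
  have h := Substructure.lift_card_closure_le (L := L) (s := A)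
  have h2 : Cardinal.lift #(Σ n, L.Functions n) ≤ ℵ₀ := by
    rw [Cardinal.lift_le_aleph0]; exact Cardinal.mk_le_aleph0
  have h3 := h.trans (max_le_max le_rfl (add_le_add le_rfl h2))
  simp only [Cardinal.lift_id'] at h3
  refine h3.trans (max_le (le_max_left _ _) ?_)
  rcases lt_or_ge #A ℵ₀ with hA | hA
  · exact (Cardinal.add_le_aleph0.2 ⟨hA.le, le_rfl⟩).trans (le_max_left _ _)
  · rw [Cardinal.add_eq_max hA, max_comm]

/-! ### The algebraic form of being Jónsson -/

/-- The ordinal `ℵ_ω`, as the type of its elements. -/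
abbrev Om : Type (u + 1) := Set.Iio (ω_ Ordinal.omega0.{u})

/-- `A ∩ ℵ_m`, for a subset `A` of `ℵ_ω`. -/
def cut (A : Set Om.{u}) (m : ℕ) : Set Om.{u} := {x ∈ A | (x : Ordinal) < ω_ (m : Ordinal)}

/-- The map `e` carries `ℵ_n` into `ℵ_m`, and nothing else. For the increasing enumeration `e` of
`A ⊆ ℵ_ω` this says that `A ∩ ℵ_m` has order type `ℵ_n`. -/
def CutAt (e : Om.{u} → Om.{u}) (m n : ℕ) : Prop :=
  ∀ x, (e x : Ordinal) < ω_ (m : Ordinal) ↔ (x : Ordinal) < ω_ (n : Ordinal)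

/-- Every algebra with countably many operations on `ℵ_ω` has a subalgebra, of order type `ℵ_ω` and
with increasing enumeration `e`, whose intersection with each `ℵ_{f n}` has order type `ℵ_n`. -/
def AlgJonsson (f : ℕ → ℕ) : Prop :=
  ∀ F : ℕ → Finset Om.{u} → Om.{u}, ∃ e : Om.{u} → Om.{u}, StrictMono e ∧
    (∀ n, CutAt e (f n) n) ∧ ClosedFam F (Set.range e)

theorem omega_lt_top (n : ℕ) : ω_ (n : Ordinal.{u}) < ω_ Ordinal.omega0.{u} :=
  Ordinal.omega_lt_omega.2 (Ordinal.natCast_lt_omega0 n)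

theorem exists_lt_omega (x : Om.{u}) : ∃ n : ℕ, (x : Ordinal) < ω_ (n : Ordinal) := by
  have h := (Ordinal.isNormal_omega.lt_iff_exists_lt Ordinal.isSuccLimit_omega0).1 x.2
  obtain ⟨a, ha, hx⟩ := h
  obtain ⟨n, rfl⟩ := Ordinal.lt_omega0.1 ha
  exact ⟨n, hx⟩

theorem omega_le_omega {m n : ℕ} (h : m ≤ n) : ω_ (m : Ordinal.{u}) ≤ ω_ (n : Ordinal.{u}) :=
  Ordinal.omega_le_omega.2 (by exact_mod_cast h)

instance : Infinite Om.{u} :=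
  Infinite.of_injective (fun n : ℕ => (⟨ω_ (n : Ordinal.{u}), omega_lt_top n⟩ : Om.{u}))
    fun a b h => by
      simpa using congrArg Subtype.val h

theorem mk_Iio_Om (x : Om.{u}) :
    #{z : Om.{u} | z < x} = Cardinal.lift.{u + 1} (x : Ordinal.{u}).card := by
  rw [← Cardinal.mk_Iio_ordinal]
  refine Cardinal.mk_congr ⟨fun z => ⟨z.1.1, z.2⟩,
    fun z => ⟨⟨z.1, lt_trans (Set.mem_Iio.1 z.2) (Set.mem_Iio.1 x.2)⟩, z.2⟩,
    fun _ => rfl, fun _ => rfl⟩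

theorem mk_lt_omega (n : ℕ) :
    #{z : Om.{u} | (z : Ordinal) < ω_ (n : Ordinal)} = ℵ_ (n : Ordinal.{u + 1}) := by
  have := mk_Iio_Om ⟨ω_ (n : Ordinal.{u}), omega_lt_top n⟩
  rw [Ordinal.card_omega, Cardinal.lift_aleph, Ordinal.lift_natCast] at this
  exact this

theorem lt_omega_iff_mk (x : Om.{u}) (n : ℕ) :
    (x : Ordinal) < ω_ (n : Ordinal) ↔ #{z : Om.{u} | z < x} < ℵ_ (n : Ordinal.{u + 1}) := by
  rw [mk_Iio_Om, Cardinal.lt_omega_iff_card_lt, Cardinal.lift_lt_aleph_natCast]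

theorem mk_Om : #Om.{u} = ℵ_ Ordinal.omega0.{u + 1} := by
  rw [Cardinal.mk_Iio_ordinal]; simp

/-- A strictly increasing map has the cut `(m, n)` if the part of its range below `ℵ_m` has
cardinality `ℵ_n` and all its proper initial segments are smaller. -/
theorem cutAt_of_mk {e : Om.{u} → Om.{u}} (he : StrictMono e) {m n : ℕ}
    (h1 : ℵ_ (n : Ordinal.{u + 1}) ≤ #(cut (Set.range e) m))
    (h2 : ∀ y ∈ cut (Set.range e) m, #{z ∈ Set.range e | z < y} < ℵ_ (n : Ordinal.{u + 1})) :
    CutAt e m n := by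
  intro x
  have himg : ∀ x, {z ∈ Set.range e | z < e x} = e '' {z | z < x} := by
    intro x; ext z
    constructor
    · rintro ⟨⟨w, rfl⟩, hw⟩; exact ⟨w, he.lt_iff_lt.1 hw, rfl⟩
    · rintro ⟨w, hw, rfl⟩; exact ⟨⟨w, rfl⟩, he hw⟩
  rw [lt_omega_iff_mk x]
  constructor
  · intro hx
    have := h2 (e x) ⟨⟨x, rfl⟩, hx⟩
    rwa [himg, Cardinal.mk_image_eq he.injective] at this
  · intro hx
    by_contra hcon
    refine (h1.trans (Cardinal.mk_le_mk_of_subset (t := {z ∈ Set.range e | z < e x}) ?_)).not_gt ?_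
    · rintro z ⟨hz, hz2⟩
      exact ⟨hz, show (z : Ordinal) < e x from lt_of_lt_of_le hz2 (not_lt.1 hcon)⟩
    · rwa [himg, Cardinal.mk_image_eq he.injective]

theorem le_of_cutAt {e : Om.{u} → Om.{u}} (he : StrictMono e) {m n : ℕ} (h : CutAt e m n) :
    n ≤ m := by
  by_contra! hlt
  let x : Om.{u} := ⟨ω_ (m : Ordinal.{u}), omega_lt_top m⟩
  have h1 := (h x).2 (Ordinal.omega_lt_omega.2 (by exact_mod_cast hlt))
  exact absurd (show e x < x from h1) (not_lt.2 (he.le_apply))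

/-- A subset of `ℵ_ω` which has at least `ℵ_n` elements below some `ℵ_m`, for each `n`, has an
increasing enumeration indexed by `ℵ_ω`. -/
theorem exists_enumeration (A : Set Om.{u})
    (hA : ∀ n : ℕ, ∃ m : ℕ, ℵ_ (n : Ordinal.{u + 1}) ≤ #(cut A m)) :
    ∃ e : Om.{u} → Om.{u}, StrictMono e ∧ Set.range e = A := by
  -- `Ordinal.enumOrd` enumerates unbounded sets, so all ordinals from `ℵ_ω` on are added to `A`.
  let A' : Set Ordinal.{u} := Subtype.val '' A ∪ Set.Ici (ω_ Ordinal.omega0.{u})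
  have hA' : ¬ BddAbove A' := by
    rintro ⟨b, hb⟩
    have := hb (Or.inr (le_max_left _ (b + 1)) : max (ω_ Ordinal.omega0.{u}) (b + 1) ∈ A')
    have h2 : b + 1 ≤ b := (le_max_right _ _).trans this
    exact absurd h2 (not_le.2 (Order.lt_add_one_iff.2 le_rfl))
  let E := Ordinal.enumOrd A'
  have hE : StrictMono E := Ordinal.enumOrd_strictMono hA'
  have hlt : ∀ x : Om.{u}, E x < ω_ Ordinal.omega0.{u} := by
    intro x
    obtain ⟨n, hn⟩ := exists_lt_omega x
    obtain ⟨m, hm⟩ := hA n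
    by_contra! hcon
    have h1 : #(cut A m) ≤ #(Set.Iio (x : Ordinal.{u})) := by
      have hex : ∀ y : cut A m, ∃ z : Set.Iio (x : Ordinal.{u}), E z = (y : Om.{u}) := by
        intro y
        obtain ⟨z, hz⟩ := Ordinal.enumOrd_surjective hA'
          (Or.inl ⟨y, y.2.1, rfl⟩ : (y : Om.{u}).1 ∈ A')
        refine ⟨⟨z, ?_⟩, hz⟩
        refine hE.lt_iff_lt.1 (lt_of_lt_of_le ?_ hcon)
        exact lt_of_eq_of_lt hz y.1.2
      choose g hg using hex
      refine Cardinal.mk_le_of_injective (f := g) fun a b hab => ?_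
      apply Subtype.ext; apply Subtype.ext
      rw [← hg, ← hg, hab]
    rw [Cardinal.mk_Iio_ordinal] at h1
    rw [Cardinal.lt_omega_iff_card_lt, ← Cardinal.lift_lt_aleph_natCast.{u, u + 1}] at hn
    exact absurd (hm.trans h1) (not_le.2 hn)
  refine ⟨fun x => ⟨E x, hlt x⟩, fun x y hxy => hE hxy, ?_⟩
  ext y
  constructor
  · rintro ⟨x, rfl⟩
    rcases Ordinal.enumOrd_mem hA' (x : Ordinal) with ⟨z, hz, hzx⟩ | h
    · convert hz
      exact Subtype.ext hzx.symm
    · exact absurd (hlt x) (not_lt.2 h)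
  · intro hy
    obtain ⟨z, hz⟩ := Ordinal.enumOrd_surjective hA' (Or.inl ⟨y, hy, rfl⟩ : y.1 ∈ A')
    refine ⟨⟨z, ?_⟩, Subtype.ext hz⟩
    exact lt_of_le_of_lt (Ordinal.le_enumOrd_self hA') (hz ▸ y.2)

/-! ### Elementary submodels of `H_{ℵ_ω}` and subalgebras of `ℵ_ω` -/

/-- The ordinals below `ℵ_ω`, as elements of `H_{ℵ_ω}`. -/
noncomputable def toH (x : Om.{u}) : H.{u} (ℵ_ Ordinal.omega0.{u}) :=
  ⟨(x : Ordinal).toZFSet, (x : Ordinal).toZFSet, (ZFSet.isOrdinal_toZFSet _).isTransitive,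
    fun _ h => h, by
      rw [Ordinal.card_toZFSet, ← Cardinal.lt_omega_iff_card_lt]; exact x.2⟩

theorem toH_injective : Function.Injective toH.{u} := fun _ _ h =>
  Subtype.ext (Ordinal.toZFSet_injective (congrArg Subtype.val h))

theorem ordPart_eq (M : Set (H.{u} (ℵ_ Ordinal.omega0.{u}))) (m : ℕ) :
    ordPart M (ω_ (m : Ordinal.{u})) = Subtype.val '' cut (toH ⁻¹' M) m := by
  ext β
  constructor
  · rintro ⟨hβ, x, hx, hxβ⟩
    refine ⟨⟨β, hβ.trans (omega_lt_top m)⟩, ⟨?_, hβ⟩, rfl⟩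
    have : toH ⟨β, hβ.trans (omega_lt_top m)⟩ = x := Subtype.ext hxβ.symm
    simpa [this] using hx
  · rintro ⟨x, ⟨hx, hxm⟩, rfl⟩
    exact ⟨hxm, toH x, hx, rfl⟩

/-- A family of operations on `ℵ_ω` extends to `H_{ℵ_ω}`, and the trace on the ordinals of a model
closed under the extension is a subalgebra. -/
theorem algJonsson_of_fJonsson {f : ℕ → ℕ} (hf : FJonsson.{u} f) : AlgJonsson.{u} f := by
  classical
  intro F
  obtain ⟨G, hG⟩ := exists_single_of_closedFam F
  obtain ⟨M, ⟨-, -, hchi⟩, hM⟩ := hf fun t => toH (G (t.preimage toH toH_injective.injOn))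
  let A : Set Om.{u} := toH ⁻¹' M
  have hA : ClosedFam F A := by
    refine hG A fun s hs => ?_
    have := hM (s.map ⟨toH, toH_injective⟩) (by
      intro y hy
      simp only [Finset.coe_map, Function.Embedding.coeFn_mk] at hy
      obtain ⟨x, hx, rfl⟩ := hy
      exact hs hx)
    have h2 : (s.map ⟨toH, toH_injective⟩).preimage toH toH_injective.injOn = s := by
      ext x; simp
    rwa [h2] at this
  have hcut : ∀ n, ot (Subtype.val '' cut A (f n)) = ω_ (n : Ordinal.{u + 1}) := fun n => by
    rw [← ordPart_eq]; exact (hchi n).2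
  have hmk : ∀ n, #(cut A (f n)) = ℵ_ (n : Ordinal.{u + 1}) := fun n => by
    have := congrArg Ordinal.card (hcut n)
    rw [ot, Ordinal.card_type, Ordinal.card_omega, Cardinal.mk_image_eq Subtype.val_injective]
      at this
    exact this
  obtain ⟨e, he, heA⟩ := exists_enumeration A fun n => ⟨f n, (hmk n).ge⟩
  refine ⟨e, he, fun n => cutAt_of_mk he ?_ ?_, heA ▸ hA⟩
  · rw [heA]; exact (hmk n).ge
  · rw [heA]
    intro y hy
    let y' : (Subtype.val '' cut A (f n) : Set Ordinal.{u}) := ⟨y, y, hy, rfl⟩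
    have h1 := Ordinal.typein_lt_type
      (fun a b : (Subtype.val '' cut A (f n) : Set Ordinal.{u}) => a < b) y'
    have h2 : Ordinal.type (fun a b : (Subtype.val '' cut A (f n) : Set Ordinal.{u}) => a < b)
      = ω_ (n : Ordinal.{u + 1}) := hcut n
    rw [h2, Cardinal.lt_omega_iff_card_lt] at h1
    refine lt_of_le_of_lt ?_ h1
    rw [Ordinal.card_typein]
    refine Cardinal.mk_le_of_injective (f := fun z : {z ∈ A | z < y} =>
      (⟨⟨z.1, z.1, ⟨z.2.1, lt_trans (show (z.1 : Ordinal) < y from z.2.2) hy.2⟩, rfl⟩, z.2.2⟩ :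
        {z : (Subtype.val '' cut A (f n) : Set Ordinal.{u}) // z < y'})) ?_
    intro a b hab
    have := congrArg (fun z => z.1.1) hab
    exact Subtype.ext (Subtype.ext this)

instance : Countable (Σ n, (LSet.sum LSet.skolem₁).Functions n) := by
  rw [← Cardinal.mk_le_aleph0_iff]
  refine card_functions_sum_skolem₁_le.trans ?_
  rw [max_le_iff]
  refine ⟨le_rfl, ?_⟩
  have : Countable (Σ n, LSet.Relations n) := by
    refine Function.Injective.countable (f := fun x : (Σ n, LSet.Relations n) => x.1) ?_
    rintro ⟨_, ⟨⟩⟩ ⟨_, ⟨⟩⟩ _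
    rfl
  have : Countable (Σ n, LSet.Functions n) :=
    ⟨fun x => Empty.elim x.2, fun x => Empty.elim x.2⟩
  rw [FirstOrder.Language.card, Cardinal.mk_le_aleph0_iff]
  infer_instance

/-- The Skolem hull of `A ⊆ ℵ_ω`, closed also under a given function on `H_{ℵ_ω}`, has no new
ordinals if `A` contains those in the hull of each of its finite subsets. -/
theorem fJonsson_of_algJonsson {f : ℕ → ℕ} (hf : AlgJonsson.{u} f) : FJonsson.{u} f := by
  classical
  intro F
  have : Nonempty (H.{u} (ℵ_ Ordinal.omega0.{u})) := ⟨toH (Classical.arbitrary Om)⟩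
  let _ := funStructure fun _ : ℕ => F
  let L := (LSet.sum LSet.skolem₁).sum funLang
  have hL : Countable (Σ n, L.Functions n) := by
    have : Countable (Σ n, funLang.Functions n) := by
      change Countable (Σ _ : ℕ, ℕ)
      infer_instance
    refine Function.Injective.countable (f := fun x : (Σ n, L.Functions n) =>
      (x.2.map (Sigma.mk x.1) (Sigma.mk x.1) :
        (Σ n, (LSet.sum LSet.skolem₁).Functions n) ⊕ (Σ n, funLang.Functions n))) ?_
    rintro ⟨m, a | a⟩ ⟨n, b | b⟩ h
    · have := Sum.inl.inj h
      cases this; rfl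
    · cases h
    · cases h
    · have := Sum.inr.inj h
      cases this; rfl
  let hull (s : Set Om.{u}) : L.Substructure (H.{u} (ℵ_ Ordinal.omega0.{u})) :=
    Substructure.closure L (toH '' s)
  have hcount : ∀ s : Finset Om.{u}, ∃ E : ℕ → Om.{u},
      toH ⁻¹' (hull (s : Set Om)) ⊆ Set.range E := by
    intro s
    have h1 : (hull (s : Set Om) : Set (H.{u} (ℵ_ Ordinal.omega0.{u}))).Countable := by
      rw [← Cardinal.le_aleph0_iff_set_countable]
      refine (mk_closure_le _).trans (max_le le_rfl ?_)
      exact Cardinal.le_aleph0_iff_set_countable.2 (s.countable_toSet.image _)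
    exact Set.countable_iff_exists_subset_range.1 (h1.preimage toH_injective)
  choose E hE using hcount
  obtain ⟨e, he, hcut, hcl⟩ := hf fun i s => E s i
  set A := Set.range e with hA
  have htrace : toH ⁻¹' (hull A) = A := by
    refine Set.Subset.antisymm (fun x hx => ?_)
      (fun x hx => Substructure.subset_closure ⟨x, hx, rfl⟩)
    obtain ⟨t, ht, hxt⟩ := mem_closure_finset
      (show toH x ∈ Substructure.closure L (toH '' A) from hx)
    obtain ⟨s, hs, rfl⟩ := Finset.subset_set_image_iff.1 ht
    rw [Finset.coe_image] at hxt
    obtain ⟨i, rfl⟩ := hE s hxt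
    exact hcl i s hs
  refine ⟨(hull A : Set _), ⟨?_, ?_, fun n => ⟨le_of_cutAt he (hcut n), ?_⟩⟩, fun s hs => ?_⟩
  · exact ⟨Substructure.elementarySkolem₁Reduct
      ((LHom.sumInl (L := LSet.sum LSet.skolem₁) (L' := funLang)).substructureReduct (hull A)), rfl⟩
  · have hAcard : #A = ℵ_ Ordinal.omega0.{u + 1} := by
      rw [hA, Cardinal.mk_range_eq _ he.injective, mk_Om]
    have himg : #(toH '' A) = ℵ_ Ordinal.omega0.{u + 1} := by
      rw [Cardinal.mk_image_eq toH_injective, hAcard]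
    refine le_antisymm ((mk_closure_le _).trans ?_) ?_
    · rw [himg]; exact max_le (Cardinal.aleph0_le_aleph _) le_rfl
    · rw [← himg]
      exact Cardinal.mk_le_mk_of_subset Substructure.subset_closure
  · rw [ordPart_eq, htrace]
    let g : Set.Iio (ω_ (n : Ordinal.{u})) → Ordinal.{u} := fun x =>
      e ⟨x, (Set.mem_Iio.1 x.2).trans (omega_lt_top n)⟩
    have hg : StrictMono g := fun a b h => he (show _ < _ from h)
    have h1 : (Subtype.val '' cut A (f n) : Set Ordinal.{u}) = Set.range g := by
      ext y
      constructor
      · rintro ⟨_, ⟨⟨x, rfl⟩, hx⟩, rfl⟩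
        exact ⟨⟨x, (hcut n x).1 hx⟩, rfl⟩
      · rintro ⟨x, rfl⟩
        exact ⟨_, ⟨⟨_, rfl⟩, (hcut n _).2 x.2⟩, rfl⟩
    rw [h1, ot]
    refine (hg.orderIso g).toRelIsoLT.ordinalType_congr.symm.trans ?_
    simp
  · refine closedFam_of_fun_mem (fun _ : ℕ => F) (hull A) (fun n i x hx => ?_) 0 s hs
    exact (hull A).fun_mem (LHom.sumInr (L := LSet.sum LSet.skolem₁) (L' := funLang)
      |>.onFunction i) x hx

/-! ### Adding the ordinals below `ℵ_n` to a subalgebra -/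

theorem mk_Iic_le {m : ℕ} {γ : Om.{u}} (h : (γ : Ordinal) < ω_ ((m + 1 : ℕ) : Ordinal)) :
    #{δ : Om.{u} | δ ≤ γ} ≤ ℵ_ (m : Ordinal.{u + 1}) := by
  rw [lt_omega_iff_mk, Nat.cast_add_one, ← Cardinal.succ_aleph, Order.lt_succ_iff] at h
  have : {δ : Om.{u} | δ ≤ γ} = insert γ {δ | δ < γ} := by
    ext δ; simp [le_iff_eq_or_lt]
  rw [this]
  refine Cardinal.mk_insert_le.trans ?_
  exact Cardinal.add_le_of_le (Cardinal.aleph0_le_aleph _) h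
    (Cardinal.one_le_aleph0.trans (Cardinal.aleph0_le_aleph _))

/-- For `γ < ℵ_{m+1}` there is an injection of `γ + 1` into `ℵ_m`. -/
theorem exists_injOn_Iic (m : ℕ) (γ : Om.{u}) : ∃ J : Om.{u} → Om.{u},
    (γ : Ordinal) < ω_ ((m + 1 : ℕ) : Ordinal) →
      Set.InjOn J {δ | δ ≤ γ} ∧ ∀ δ ≤ γ, (J δ : Ordinal) < ω_ (m : Ordinal) := by
  classical
  by_cases h : (γ : Ordinal) < ω_ ((m + 1 : ℕ) : Ordinal)
  · have h1 := mk_Iic_le h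
    rw [← mk_lt_omega] at h1
    obtain ⟨j⟩ := h1
    refine ⟨fun δ => if hδ : δ ≤ γ then (j ⟨δ, hδ⟩).1 else δ, fun _ => ⟨?_, ?_⟩⟩
    · intro a ha b hb hab
      have ha' : a ≤ γ := ha
      have hb' : b ≤ γ := hb
      simp only [ha', hb', dif_pos] at hab
      exact congrArg Subtype.val (j.injective (Subtype.ext hab))
    · intro δ hδ
      simp only [hδ, dif_pos]
      exact (j ⟨δ, hδ⟩).2
  · exact ⟨id, fun h' => absurd h' h⟩

/-- A subset of `ℵ_ω` of size at most `ℵ_n` is bounded in `ℵ_m` for `m > n`, as `ℵ_m` is regular. -/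
theorem exists_bound {S : Set Om.{u}} {n m : ℕ} (hS : #S ≤ ℵ_ (n : Ordinal.{u + 1})) (hm : n < m) :
    ∃ b : Om.{u}, (b : Ordinal) < ω_ (m : Ordinal) ∧ ∀ x ∈ cut S m, x ≤ b := by
  have hlt : sSup (Subtype.val '' cut S m : Set Ordinal.{u}) < ω_ (m : Ordinal.{u}) := by
    obtain ⟨k, rfl⟩ : ∃ k, m = k + 1 := ⟨m - 1, by omega⟩
    refine Ordinal.sSup_lt_of_lt_cof ?_ ?_
    · have hcof : (ω_ ((k + 1 : ℕ) : Ordinal.{u + 1})).cof = ℵ_ ((k + 1 : ℕ) : Ordinal) := by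
        rw [Nat.cast_add_one, ← Cardinal.ord_aleph, (Cardinal.isRegular_aleph_add_one _).cof_ord]
      rw [Ordinal.lift_omega, Ordinal.lift_natCast, hcof,
        Cardinal.mk_image_eq Subtype.val_injective]
      refine ((Cardinal.mk_le_mk_of_subset fun x hx => hx.1).trans hS).trans_lt ?_
      exact Cardinal.aleph_lt_aleph.2 (by exact_mod_cast hm)
    · rintro _ ⟨y, hy, rfl⟩
      exact hy.2
  refine ⟨⟨_, hlt.trans (omega_lt_top m)⟩, hlt, fun x hx => ?_⟩
  refine le_csSup (α := Ordinal.{u}) ⟨ω_ (m : Ordinal.{u}), ?_⟩ ⟨x, hx, rfl⟩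
  rintro _ ⟨y, hy, rfl⟩
  exact hy.2.le

theorem mk_cut_range {e : Om.{u} → Om.{u}} (he : StrictMono e) {m n : ℕ} (h : CutAt e m n) :
    #(cut (Set.range e) m) = ℵ_ (n : Ordinal.{u + 1}) := by
  rw [← mk_lt_omega,
    ← Cardinal.mk_image_eq (s := {z : Om.{u} | (z : Ordinal) < ω_ (n : Ordinal)}) he.injective]
  congr 2
  ext y
  constructor
  · rintro ⟨⟨x, rfl⟩, hx⟩; exact ⟨x, (h x).1 hx, rfl⟩
  · rintro ⟨x, hx, rfl⟩; exact ⟨⟨x, rfl⟩, (h x).2 hx⟩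

theorem eq_self_of_subset_range {e : Om.{u} → Om.{u}} (he : StrictMono e) {n : ℕ}
    (h : {x : Om.{u} | (x : Ordinal) < ω_ (n : Ordinal)} ⊆ Set.range e) (x : Om.{u})
    (hx : (x : Ordinal) < ω_ (n : Ordinal)) : e x = x := by
  induction x using WellFoundedLT.induction with
  | _ x ih =>
    obtain ⟨z, rfl⟩ := h hx
    rcases (he.le_apply : z ≤ e z).lt_or_eq with hlt | heq
    · exact congrArg e (ih z hlt (lt_trans (show (z : Ordinal) < e z from hlt) hx))
    · exact congrArg e heq.symm

/-- If `A` is cofinal in `B` below `ℵ_m` for all `m > n`, and the part of `B` up to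
`γ ∈ A ∩ ℵ_{m+1}` is never larger than `B ∩ ℵ_m`, then `|B ∩ ℵ_m| ≤ |A ∩ ℵ_m| + ℵ_n`. -/
theorem mk_cut_le {A B : Set Om.{u}} {n : ℕ}
    (hcof : ∀ m, n < m → ∀ x ∈ cut B m, ∃ γ ∈ cut A m, x ≤ γ)
    (hle : ∀ m, ∀ γ ∈ cut A (m + 1), #{δ ∈ B | δ ≤ γ} ≤ #(cut B m)) (m : ℕ) :
    #(cut B m) ≤ max #(cut A m) (ℵ_ (n : Ordinal.{u + 1})) := by
  induction m with
  | zero =>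
    refine le_max_of_le_right ((Cardinal.mk_le_mk_of_subset fun x hx => hx.2).trans
      ((mk_lt_omega 0).le.trans ?_))
    simp
  | succ m ih =>
    rcases le_or_gt (m + 1) n with hmn | hmn
    · refine le_max_of_le_right ((Cardinal.mk_le_mk_of_subset fun x hx => hx.2).trans
        ((mk_lt_omega (m + 1)).le.trans ?_))
      exact Cardinal.aleph_le_aleph.2 (by exact_mod_cast hmn)
    · have hsub : cut B (m + 1) ⊆ ⋃ γ : cut A (m + 1), {δ ∈ B | δ ≤ γ.1} := by
        intro x hx
        obtain ⟨γ, hγ, hxγ⟩ := hcof _ hmn x hx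
        exact Set.mem_iUnion.2 ⟨⟨γ, hγ⟩, hx.1, hxγ⟩
      have h0 : ℵ₀ ≤ max #(cut A (m + 1)) (ℵ_ (n : Ordinal.{u + 1})) :=
        le_max_of_le_right (Cardinal.aleph0_le_aleph _)
      have hmono : #(cut A m) ≤ #(cut A (m + 1)) :=
        Cardinal.mk_le_mk_of_subset fun x hx => ⟨hx.1, hx.2.trans_le (omega_le_omega m.le_succ)⟩
      have hsup : ∀ γ : cut A (m + 1), #{δ ∈ B | δ ≤ γ.1} ≤
          max #(cut A (m + 1)) (ℵ_ (n : Ordinal.{u + 1})) := fun γ =>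
        (hle m γ.1 γ.2).trans (ih.trans (max_le_max_right _ hmono))
      calc #(cut B (m + 1)) ≤ #(⋃ γ : cut A (m + 1), {δ ∈ B | δ ≤ γ.1}) :=
            Cardinal.mk_le_mk_of_subset hsub
        _ ≤ #(cut A (m + 1)) * ⨆ γ : cut A (m + 1), #{δ ∈ B | δ ≤ γ.1} := Cardinal.mk_iUnion_le _
        _ ≤ max #(cut A (m + 1)) (ℵ_ (n : Ordinal.{u + 1})) *
              max #(cut A (m + 1)) (ℵ_ (n : Ordinal.{u + 1})) :=
            mul_le_mul' (le_max_left _ _) (ciSup_le' hsup)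
        _ = max #(cut A (m + 1)) (ℵ_ (n : Ordinal.{u + 1})) := Cardinal.mul_eq_self h0

/-- If `A` meets `ℵ_{f j}` in order type `ℵ_j`, then so does the algebra `B` generated by
`A ∪ ℵ_n`, for `j > n`. Indeed, `A` is cofinal in `B` below every `ℵ_m` with `m > n`, because it is
closed under the suprema of the intersections with `ℵ_m` of the algebras generated by a finite set
and `ℵ_n`. So `|B ∩ ℵ_m| ≤ |A ∩ ℵ_m| + ℵ_n` by induction on `m`, using that `B` is closed under
injections of the ordinals below `ℵ_{m+1}` into `ℵ_m`. -/
theorem AlgJonsson.exists_fix {f : ℕ → ℕ} (hf : AlgJonsson.{u} f) (n : ℕ)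
    (F : ℕ → Finset Om.{u} → Om.{u}) : ∃ e : Om.{u} → Om.{u}, StrictMono e ∧
      (∀ x : Om.{u}, (x : Ordinal) < ω_ (n : Ordinal) → e x = x) ∧
      (∀ j, n < j → CutAt e (f j) j) ∧ ClosedFam F (Set.range e) := by
  classical
  choose J hJ using exists_injOn_Iic.{u}
  let J' (m : ℕ) (s : Finset Om.{u}) : Om.{u} :=
    if h : s.Nonempty then J m (s.max' h) (s.min' h) else Classical.arbitrary _
  let F' : ℕ → Finset Om.{u} → Om.{u} := fun i =>
    Sum.elim F J' (Equiv.natSumNatEquivNat.symm i)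
  let _ := funStructure F'
  have : Countable (Σ n, funLang.Functions n) := by
    change Countable (Σ _ : ℕ, ℕ)
    infer_instance
  let I : Set Om.{u} := {x | (x : Ordinal) < ω_ (n : Ordinal)}
  let cl (S : Set Om.{u}) : Set Om.{u} := Substructure.closure funLang (S ∪ I)
  have hσ : ∀ (m : ℕ) (s : Finset Om.{u}), ∃ b : Om.{u}, n < m →
      (b : Ordinal) < ω_ (m : Ordinal) ∧ ∀ x ∈ cut (cl s) m, x ≤ b := by
    intro m s
    by_cases hm : n < m
    · have hs : #(cl s) ≤ ℵ_ (n : Ordinal.{u + 1}) := by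
        have h0 := Cardinal.aleph0_le_aleph (n : Ordinal.{u + 1})
        refine (mk_closure_le _).trans (max_le h0 ?_)
        refine (Cardinal.mk_union_le _ _).trans (Cardinal.add_le_of_le h0 ?_ (mk_lt_omega n).le)
        exact (Cardinal.mk_le_aleph0 (α := s)).trans h0
      obtain ⟨b, hb⟩ := exists_bound hs hm
      exact ⟨b, fun _ => hb⟩
    · exact ⟨Classical.arbitrary _, fun h => absurd h hm⟩
  choose σ hσ using hσ
  obtain ⟨e₀, he₀, hcut₀, hcl₀⟩ := hf fun i =>
    Sum.elim σ (fun (m : ℕ) _ => ⟨ω_ (m : Ordinal.{u}), omega_lt_top m⟩)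
      (Equiv.natSumNatEquivNat.symm i)
  set A := Set.range e₀ with hA
  have hAσ : ∀ m (s : Finset Om.{u}), (s : Set Om) ⊆ A → σ m s ∈ A := fun m s hs => by
    simpa using hcl₀ (Equiv.natSumNatEquivNat (Sum.inl m)) s hs
  have hAω : ∀ m : ℕ, (⟨ω_ (m : Ordinal.{u}), omega_lt_top m⟩ : Om.{u}) ∈ A := fun m => by
    simpa using hcl₀ (Equiv.natSumNatEquivNat (Sum.inr m)) ∅ (by simp)
  set B := cl A with hB
  have hBF' : ClosedFam F' B := closedFam_of_fun_mem F' B fun k i x hx =>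
    (Substructure.closure funLang (A ∪ I)).fun_mem i x hx
  have hBF : ClosedFam F B := fun i s hs => by
    simpa [F'] using hBF' (Equiv.natSumNatEquivNat (Sum.inl i)) s hs
  have hBJ : ∀ (m : ℕ), ∀ γ ∈ B, ∀ δ ∈ B, δ ≤ γ → J m γ δ ∈ B := by
    intro m γ hγ δ hδ hle
    have := hBF' (Equiv.natSumNatEquivNat (Sum.inr m)) {γ, δ} (by
      intro x hx
      simp only [Finset.coe_insert, Finset.coe_singleton, Set.mem_insert_iff,
        Set.mem_singleton_iff] at hx
      rcases hx with rfl | rfl <;> assumption)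
    have hne : ({γ, δ} : Finset Om.{u}).Nonempty := ⟨γ, by simp⟩
    have hmax : ({γ, δ} : Finset Om.{u}).max' hne = γ :=
      le_antisymm (Finset.max'_le _ _ _ (by simp [hle])) (Finset.le_max' _ _ (by simp))
    have hmin : ({γ, δ} : Finset Om.{u}).min' hne = δ :=
      le_antisymm (Finset.min'_le _ _ (by simp)) (Finset.le_min' _ _ _ (by simp [hle]))
    simpa only [F', J', Equiv.symm_apply_apply, Sum.elim_inr, dif_pos hne, hmax, hmin] using this
  have hAB : A ⊆ B := fun x hx => Substructure.subset_closure (Or.inl hx)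
  have hcof : ∀ m, n < m → ∀ x ∈ cut B m, ∃ γ ∈ cut A m, x ≤ γ := by
    rintro m hm x ⟨hx, hxm⟩
    obtain ⟨t, ht, hxt⟩ := mem_closure_finset hx
    have hsA : ((t.filter (· ∈ A) : Finset Om.{u}) : Set Om) ⊆ A := fun y hy => by
      simpa using (Finset.mem_filter.1 (Finset.mem_coe.1 hy)).2
    refine ⟨σ m (t.filter (· ∈ A)), ⟨hAσ m _ hsA, (hσ m _ hm).1⟩, (hσ m _ hm).2 x ⟨?_, hxm⟩⟩
    refine Substructure.closure_mono (fun y hy => ?_) hxt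
    rcases ht hy with h | h
    · exact Or.inl (Finset.mem_coe.2 (Finset.mem_filter.2 ⟨hy, h⟩))
    · exact Or.inr h
  have hle : ∀ m, ∀ γ ∈ cut A (m + 1), #{δ ∈ B | δ ≤ γ} ≤ #(cut B m) := by
    rintro m γ ⟨hγ, hγm⟩
    obtain ⟨h1, h2⟩ := hJ m γ hγm
    refine Cardinal.mk_le_of_injective (f := fun δ : {δ ∈ B | δ ≤ γ} =>
      (⟨J m γ δ, hBJ m γ (hAB hγ) δ δ.2.1 δ.2.2, h2 δ δ.2.2⟩ : cut B m)) fun a b hab => ?_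
    exact Subtype.ext (h1 a.2.2 b.2.2 (congrArg Subtype.val hab))
  have hcard := mk_cut_le hcof hle
  obtain ⟨e, he, heB⟩ := exists_enumeration B fun k => by
    refine ⟨f (max k (n + 1)), le_trans ?_ (Cardinal.mk_le_mk_of_subset
      (s := cut A _) fun x hx => ⟨hAB hx.1, hx.2⟩)⟩
    rw [hA, mk_cut_range he₀ (hcut₀ _)]
    exact Cardinal.aleph_le_aleph.2 (by exact_mod_cast le_max_left _ _)
  refine ⟨e, he, eq_self_of_subset_range he ?_, fun j hj => cutAt_of_mk he ?_ ?_, heB ▸ hBF⟩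
  · rw [heB]
    exact fun x hx => Substructure.subset_closure (Or.inr hx)
  · rw [heB, ← mk_cut_range he₀ (hcut₀ j)]
    exact Cardinal.mk_le_mk_of_subset fun x hx => ⟨hAB hx.1, hx.2⟩
  · rw [heB]
    intro y hy
    have hjf : j ≤ f j := le_of_cutAt he₀ (hcut₀ j)
    have hcutj := hcut₀ j
    obtain ⟨k, hk⟩ : ∃ k, f j = k + 1 := ⟨f j - 1, by omega⟩
    rw [hk] at hy hcutj
    obtain ⟨γ, hγ, hyγ⟩ := hcof (k + 1) (by omega) y hy
    refine lt_of_le_of_lt ((Cardinal.mk_le_mk_of_subset (t := {δ ∈ B | δ ≤ γ}) fun z hz =>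
      ⟨hz.1, hz.2.le.trans hyγ⟩).trans ((hle k γ hγ).trans (hcard k))) (max_lt ?_ ?_)
    · -- `ℵ_k` belongs to `A`, so `A ∩ ℵ_k` is a proper initial segment of `A ∩ ℵ_{k+1}`.
      obtain ⟨w, hw⟩ := hAω k
      have hwj : (w : Ordinal) < ω_ (j : Ordinal) := by
        rw [← hcutj w, hw]
        exact Ordinal.omega_lt_omega.2 (by exact_mod_cast k.lt_succ_self)
      refine lt_of_le_of_lt ?_ ((lt_omega_iff_mk w j).1 hwj)
      rw [← Cardinal.mk_image_eq (s := {z | z < w}) he₀.injective]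
      refine Cardinal.mk_le_mk_of_subset ?_
      rintro _ ⟨⟨x, rfl⟩, hx⟩
      refine ⟨x, he₀.lt_iff_lt.1 ?_, rfl⟩
      rw [hw]; exact hx
    · exact Cardinal.aleph_lt_aleph.2 (by exact_mod_cast hj)

/-- The elements `n` of an initial segment `D` of `ℕ` can be exempted: up to their supremum the
subalgebra contains all ordinals. -/
theorem AlgJonsson.exists_fix_of_isLowerSet {f : ℕ → ℕ} (hf : AlgJonsson.{u} f) {D : Set ℕ}
    (hD : IsLowerSet D) (F : ℕ → Finset Om.{u} → Om.{u}) : ∃ e : Om.{u} → Om.{u}, StrictMono e ∧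
      (∀ n ∈ D, ∀ x : Om.{u}, (x : Ordinal) < ω_ (n : Ordinal) → e x = x) ∧
      (∀ n ∉ D, CutAt e (f n) n) ∧ ClosedFam F (Set.range e) := by
  by_cases hb : BddAbove D
  · rcases D.eq_empty_or_nonempty with rfl | hne
    · obtain ⟨e, he, hc, hF⟩ := hf F
      exact ⟨e, he, by simp, fun n _ => hc n, hF⟩
    · have hmem := Nat.sSup_mem hne hb
      obtain ⟨e, he, hfix, hc, hF⟩ := hf.exists_fix (sSup D) F
      refine ⟨e, he, fun n hn x hx => hfix x (hx.trans_le (omega_le_omega (le_csSup hb hn))),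
        fun n hn => hc n ?_, hF⟩
      by_contra! hle
      exact hn (hD hle hmem)
  · refine ⟨id, strictMono_id, fun _ _ _ _ => rfl, fun n hn => (hb ⟨n, fun m hm => ?_⟩).elim,
      fun i s _ => by simp⟩
    by_contra! hlt
    exact hn (hD hlt.le hm)

/-! ### Iteration along a monotone function -/

/-- The subalgebras are refined `ω` times. In the `k`-th step the current subalgebra, identified
with `ℵ_ω` by its enumeration `E k`, is replaced by a subalgebra of type `f k` which contains all
ordinals below `ℵ_n` whenever `g n ≤ k`. So `E k x` is eventually constant for each `x`, and the
limit enumerates the intersection of all these subalgebras. -/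
theorem algJonsson_seqPow {f : ℕ → ℕ → ℕ} {g : ℕ → ℕ} (hf : ∀ i, AlgJonsson.{u} (f i))
    (hg : Monotone g) : AlgJonsson.{u} (seqPow f g) := by
  classical
  intro F
  have hle : ∀ i n, n ≤ f i n := fun i n => by
    obtain ⟨e, he, hc, -⟩ := hf i fun _ _ => Classical.arbitrary _
    exact le_of_cutAt he (hc n)
  have step : ∀ (k : ℕ) (H : ℕ → Finset Om.{u} → Om.{u}),
      ∃ (e : Om.{u} → Om.{u}) (G : ℕ → Finset Om.{u} → Om.{u}), StrictMono e ∧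
        (∀ n, g n ≤ k → ∀ x : Om.{u}, (x : Ordinal) < ω_ (n : Ordinal) → e x = x) ∧
        (∀ n, k < g n → CutAt e (f k n) n) ∧ ∀ i s, H i (s.image e) = e (G i s) := by
    intro k H
    obtain ⟨e, he, h1, h2, h3⟩ := (hf k).exists_fix_of_isLowerSet
      (D := {n | g n ≤ k}) (fun a b hba ha => (hg hba).trans ha) H
    have h4 : ∀ i (s : Finset Om.{u}), ∃ y, H i (s.image e) = e y := fun i s => by
      obtain ⟨y, hy⟩ := h3 i (s.image e) (by simp)
      exact ⟨y, hy.symm⟩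
    choose G hG using h4
    exact ⟨e, G, he, h1, fun n hn => h2 n (not_le.2 hn), hG⟩
  choose e₀ G he₀ hfix₀ hcut₀ hG using step
  let Fs : ℕ → ℕ → Finset Om.{u} → Om.{u} := fun k => Nat.rec F (fun k Fk => G k Fk) k
  let e : ℕ → Om.{u} → Om.{u} := fun k => e₀ k (Fs k)
  let E : ℕ → Om.{u} → Om.{u} := fun k => Nat.rec id (fun k Ek => Ek ∘ e k) k
  have he : ∀ k, StrictMono (e k) := fun k => he₀ k _
  have hE : ∀ k, StrictMono (E k) := fun k => by
    induction k with
    | zero => exact strictMono_id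
    | succ k ih => exact ih.comp (he k)
  have hEF : ∀ k i (s : Finset Om.{u}), F i (s.image (E k)) = E k (Fs k i s) := by
    intro k
    induction k with
    | zero => intro i s; simp [E, Fs]
    | succ k ih =>
      intro i s
      change F i (s.image (E k ∘ e k)) = E k (e k (G k (Fs k) i s))
      rw [← Finset.image_image, ih]
      exact congrArg (E k) (hG k (Fs k) i s)
  have hEcut : ∀ k n, k ≤ g n → CutAt (E k) (compFirst f k n) n := by
    intro k
    induction k with
    | zero => intro n _ x; rfl
    | succ k ih =>
      intro n hn x
      exact (ih (f k n) (by have := hg (hle k n); omega) (e k x)).trans (hcut₀ k _ n hn x)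
  have hstab : ∀ (n : ℕ) (x : Om.{u}), (x : Ordinal) < ω_ (n : Ordinal) → ∀ k, g n ≤ k →
      E k x = E (g n) x := by
    intro n x hx k hk
    induction k, hk using Nat.le_induction with
    | base => rfl
    | succ k hk ih => exact (congrArg (E k) (hfix₀ k _ n hk x hx)).trans ih
  have hEcut' : ∀ n k, g n ≤ k → CutAt (E k) (seqPow f g n) n := by
    intro n k hk
    induction k, hk using Nat.le_induction with
    | base => exact hEcut _ n le_rfl
    | succ k hk ih =>
      intro x
      refine (ih (e k x)).trans ⟨fun h => ?_, fun h => ?_⟩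
      · exact lt_of_le_of_lt (show (x : Ordinal) ≤ e k x from (he k).le_apply) h
      · have hx : e k x = x := hfix₀ k _ n hk x h
        rwa [hx]
  have hEmono : ∀ j k, j ≤ k → ∀ x, E j x ≤ E k x := by
    intro j k hjk
    induction k, hjk using Nat.le_induction with
    | base => exact fun _ => le_rfl
    | succ k _ ih =>
      exact fun x => (ih x).trans ((hE k).monotone (he k).le_apply)
  choose N hN using exists_lt_omega.{u}
  let e' : Om.{u} → Om.{u} := fun x => E (g (N x)) x
  have he' : ∀ (n : ℕ) (x : Om.{u}), (x : Ordinal) < ω_ (n : Ordinal) → ∀ k, g n ≤ k →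
      e' x = E k x := by
    intro n x hx k hk
    rw [hstab n x hx k hk, ← hstab n x hx (max k (g (N x))) (hk.trans (le_max_left _ _)),
      hstab (N x) x (hN x) _ (le_max_right _ _)]
  refine ⟨e', fun x y hxy => ?_, fun n x => ?_, fun i s hs => ?_⟩
  · rw [he' _ x (hN x) (max (g (N x)) (g (N y))) (le_max_left _ _),
      he' _ y (hN y) (max (g (N x)) (g (N y))) (le_max_right _ _)]
    exact hE _ hxy
  · rw [he' _ x (hN x) (max (g (N x)) (g n)) (le_max_left _ _)]
    exact hEcut' n _ (le_max_right _ _) x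
  · rw [← Set.image_univ] at hs
    obtain ⟨t, -, rfl⟩ := Finset.subset_set_image_iff.1 hs
    let K := t.sup fun x => g (N x)
    have himg : ∀ k, K ≤ k → t.image e' = t.image (E k) := fun k hk =>
      Finset.image_congr fun x hx => he' _ x (hN x) k
        ((Finset.le_sup (f := fun x => g (N x)) hx).trans hk)
    -- The value of the operation is `E k y'` for all large `k`, where `y'` depends on `k` but never
    -- exceeds its value `y` for `k = K`; so one `k` serves for the limit as well.
    let y := Fs K i t
    let k := max K (g (N y))
    have h1 : F i (t.image e') = E K y := by rw [himg K le_rfl, hEF]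
    have h2 : F i (t.image e') = E k (Fs k i t) := by rw [himg k (le_max_left _ _), hEF]
    have h3 : Fs k i t ≤ y := by
      rw [← (hE K).le_iff_le, ← h1, h2]
      exact hEmono _ _ (le_max_left _ _) _
    refine ⟨Fs k i t, ?_⟩
    rw [h2]
    exact he' (N y) _ (lt_of_le_of_lt (Subtype.coe_le_coe.2 h3) (hN y)) k
      (le_max_right _ _)

theorem fJonsson_seqPow {f : ℕ → ℕ → ℕ} {g : ℕ → ℕ} (hf : ∀ i, FJonsson.{u} (f i))
    (hg : Monotone g) : FJonsson.{u} (seqPow f g) :=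
  fJonsson_of_algJonsson (algJonsson_seqPow (fun i => algJonsson_of_fJonsson (hf i)) hg)

theorem compFirst_s₁ (k n : ℕ) : compFirst (fun _ => s₁) k n = if n = 0 then 0 else n + k := by
  induction k generalizing n with
  | zero => simp [compFirst]
  | succ k ih =>
    change compFirst (fun _ => s₁) k (s₁ n) = _
    rw [ih, s₁]
    split_ifs <;> omega

/-- An increasing `f` with `f 0 = 0` moves `n` by the `(f n - n)`-fold iterate of `s₁`, and
`f n - n` increases with `n`. -/
theorem fJonsson_of_strictMono (h : FJonsson.{u} s₁) {f : ℕ → ℕ} (hf : StrictMono f)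
    (h0 : f 0 = 0) : FJonsson.{u} f := by
  have hg : Monotone fun n => f n - n := monotone_nat_of_le_succ fun n => by
    have := hf n.lt_succ_self
    simp only [Nat.succ_eq_add_one] at this
    omega
  convert fJonsson_seqPow (fun _ => h) hg using 1
  funext n
  rw [seqPow, compFirst_s₁]
  have : n ≤ f n := hf.le_apply
  split_ifs with hn
  · rw [hn, h0]
  · omega

end Jonsson

theorem mainTheorem2 :
    (∀ (f : ℕ → ℕ → ℕ) (g : ℕ → ℕ),
      (∀ i, Jonsson.FJonsson.{u} (f i)) → Monotone g →
        Jonsson.FJonsson.{u} (Jonsson.seqPow f g)) ∧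
    (Jonsson.FJonsson.{u} Jonsson.s₁ →
      ∀ f : ℕ → ℕ, StrictMono f → f 0 = 0 → Jonsson.FJonsson.{u} f) :=
  ⟨fun _ _ hf hg => Jonsson.fJonsson_seqPow hf hg,
    fun h _ hf h0 => Jonsson.fJonsson_of_strictMono h hf h0⟩
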